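/- In the game of Cops and Robbers on a connected graph $G$ (with at least one vertex), the cop player first places $n$ cops on vertices (several cops may share a vertex), then the robber player, seeing this, places the robber on a vertex. The players then alternate turns, the cops first: in the cops' turn each cop moves to an adjacent vertex or stays where it is, and in the robber's turn the robber moves to an adjacent vertex or stays. The cops win if after finitely many turns some cop moves onto the vertex occupied by the robber. The cop number $c(G)$ is the least $n$ such that $n$ cops have a strategy that wins however the robber plays. Write $P_k$ for the path on $k$ vertices, $C_k$ for the cycle on $k$ vertices, claw for the complete bipartite graph $K_{1,3}$, and butterfly for the $5$-vertex graph obtained by identifying two triangles at a vertex. **Theorem.** Let $G$ be a connected graph, and let $k$ be a non-negative integer. If no induced subgraph of $G$ is isomorphic to $P_k$, the claw, the butterfly, $C_4$ or $C_5$, then $$c(G)\le\left\lceil\frac{k-1}{3}\right\rceil+3 .$$ -/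

import Mathlib

namespace SimpleGraph

/-- The butterfly: two triangles `0,1,2` and `0,3,4` identified at the vertex `0`. -/
def butterflyGraph : SimpleGraph (Fin 5) :=
  fromEdgeSet {s(0, 1), s(0, 2), s(1, 2), s(0, 3), s(0, 4), s(3, 4)}

/-- The claw `K_{1,3}`. -/
def clawGraph : SimpleGraph (Fin 1 ⊕ Fin 3) :=
  completeBipartiteGraph (Fin 1) (Fin 3)

/-- `G` is `H`-free: no induced subgraph of `G` is isomorphic to `H`. -/
def IsIndFree {V W : Type*} (G : SimpleGraph V) (H : SimpleGraph W) : Prop :=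
  ¬ H.IsIndContained G

/-- A move of one player from `u` to `v`: pass, or go to an adjacent vertex. -/
def IsGameMove {V : Type*} (G : SimpleGraph V) (u v : V) : Prop :=
  v = u ∨ G.Adj u v

/-- A strategy for `n` cops. It sends the list of the positions the robber has occupied so far
(most recent first) to the positions of the cops. So `σ []` is the initial placement of the cops,
made before the robber chooses a vertex, and `σ [rᵢ, …, r₀]` are the positions of the cops after
their move in answer to `rᵢ`. In each turn every cop makes a legal move. -/
def IsCopStrategy {V : Type*} (G : SimpleGraph V) {n : ℕ} (σ : List V → Fin n → V) : Prop :=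
  ∀ (h : List V) (v : V) (j : Fin n), G.IsGameMove (σ h j) (σ (v :: h) j)

/-- An infinite play of the robber: an arbitrary starting vertex, then one legal move per turn. -/
def IsRobberPlay {V : Type*} (G : SimpleGraph V) (r : ℕ → V) : Prop :=
  ∀ i : ℕ, G.IsGameMove (r i) (r (i + 1))

/-- The list `[rᵢ₋₁, …, r₀]` of the first `i` positions of the robber, most recent first. -/
def robberHistory {V : Type*} (r : ℕ → V) : ℕ → List V
  | 0 => []
  | i + 1 => r i :: robberHistory r i

/-- `n` cops have a winning strategy on `G`: however the robber plays, after finitely many turns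
some cop moves onto the vertex occupied by the robber. -/
def CopsWin {V : Type*} (G : SimpleGraph V) (n : ℕ) : Prop :=
  ∃ σ : List V → Fin n → V, G.IsCopStrategy σ ∧
    ∀ r : ℕ → V, G.IsRobberPlay r →
      ∃ (i : ℕ) (j : Fin n), σ (robberHistory r (i + 1)) j = r i

/-- The cop number `c(G)`: the least `n` such that `n` cops have a winning strategy
(`⊤` if there is no such `n`, which can happen only for infinite graphs). -/
noncomputable def copNumber {V : Type*} (G : SimpleGraph V) : ℕ∞ :=
  ⨅ (n : ℕ) (_ : G.CopsWin n), (n : ℕ∞)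

end SimpleGraph

namespace SimpleGraph

variable {V : Type*} {G : SimpleGraph V}

/-! All cops start at `u` and march as a train, one on every third vertex, along an induced path
from `u` to the robber. A robber fleeing ahead of the train only produces another induced path, and
such paths have fewer than `k` vertices. A robber dodging backwards must, by claw-freeness, see both
vertices of a gap between two cops. The gap advances with the train, and the missing claw and
butterfly then force the robber either back to the path's end or to keep seeing that end and the
moving gap. So the head reaches the end and the robber is caught (`winsIn_train`). -/

/-! ### Forbidden induced subgraphs as adjacency rules. -/

theorem IsIndFree.false {W : Type*} {H : SimpleGraph W} (h : G.IsIndFree H) (f : W → V)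
    (hinj : ∀ a b, f a = f b → a = b) (hadj : ∀ a b, G.Adj (f a) (f b) ↔ H.Adj a b) : False :=
  h ⟨⟨⟨f, hinj⟩, fun {a b} => hadj a b⟩⟩

theorem adj_of_clawFree (h : G.IsIndFree clawGraph) {x a b c : V} (ha : G.Adj x a)
    (hb : G.Adj x b) (hc : G.Adj x c) (hab : a ≠ b) (hac : a ≠ c) (hbc : b ≠ c) :
    G.Adj a b ∨ G.Adj a c ∨ G.Adj b c := by
  by_contra hn
  push Not at hn
  obtain ⟨n1, n2, n3⟩ := hn
  have n1' := mt G.adj_symm n1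
  have n2' := mt G.adj_symm n2
  have n3' := mt G.adj_symm n3
  refine h.false (Sum.elim (fun _ => x) ![a, b, c]) ?_ ?_
  · rintro (i | i) (j | j) hij
    · exact congrArg _ (Subsingleton.elim _ _)
    · exfalso; fin_cases j <;> simp at hij <;> subst hij <;> simp_all
    · exfalso; fin_cases i <;> simp at hij <;> subst hij <;> simp_all
    · fin_cases i <;> fin_cases j <;> simp_all [eq_comm]
  · rintro (i | i) (j | j)
    · simp [clawGraph]
    · fin_cases j <;> simp_all [clawGraph]
    · fin_cases i <;> simp_all [clawGraph, G.adj_comm]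
    · fin_cases i <;> fin_cases j <;> simp_all [clawGraph]

theorem adj_of_butterflyFree (h : G.IsIndFree butterflyGraph) {x a b c d : V}
    (ha : G.Adj x a) (hb : G.Adj x b) (hc : G.Adj x c) (hd : G.Adj x d)
    (hab : G.Adj a b) (hcd : G.Adj c d)
    (hac : a ≠ c) (had : a ≠ d) (hbc : b ≠ c) (hbd : b ≠ d) :
    G.Adj a c ∨ G.Adj a d ∨ G.Adj b c ∨ G.Adj b d := by
  by_contra hn
  push Not at hn
  obtain ⟨n1, n2, n3, n4⟩ := hn
  have n1' := mt G.adj_symm n1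
  have n2' := mt G.adj_symm n2
  have n3' := mt G.adj_symm n3
  have n4' := mt G.adj_symm n4
  have ha' := ha.symm
  have hb' := hb.symm
  have hc' := hc.symm
  have hd' := hd.symm
  have hab' := hab.symm
  have hcd' := hcd.symm
  refine h.false ![x, a, b, c, d] ?_ ?_
  · intro i j hij
    have e1 := ha.ne
    have e2 := hb.ne
    have e3 := hc.ne
    have e4 := hd.ne
    have e5 := hab.ne
    have e6 := hcd.ne
    fin_cases i <;> fin_cases j <;> simp_all [eq_comm]
  · intro i j
    fin_cases i <;> fin_cases j <;> simp [butterflyGraph, *]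

/-! ### From bounded wins to strategies. -/

/-- `n` cops at `c`, to move against a robber at `r`, can win within `m` cop moves. -/
def WinsIn (G : SimpleGraph V) {n : ℕ} : ℕ → (Fin n → V) → V → Prop
  | 0, _, _ => False
  | m + 1, c, r => ∃ c' : Fin n → V, (∀ i, G.IsGameMove (c i) (c' i)) ∧
      ((∃ i, c' i = r) ∨ ∀ r', G.IsGameMove r r' → WinsIn G m c' r')

theorem WinsIn.of_isGameMove {n m : ℕ} {c : Fin n → V} {r : V} (i : Fin n)
    (h : G.IsGameMove (c i) r) : G.WinsIn (m + 1) c r := by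
  classical
  refine ⟨Function.update c i r, fun l => ?_, Or.inl ⟨i, by simp⟩⟩
  by_cases hl : l = i
  · subst hl; simpa using h
  · simp [hl, IsGameMove]

open Classical in
/-- A move of the cops after which a winning position is won in fewer moves. -/
noncomputable def bestMove (G : SimpleGraph V) {n : ℕ} (c : Fin n → V) (r : V) : Fin n → V :=
  if h : ∃ c' : Fin n → V, (∀ i, G.IsGameMove (c i) (c' i)) ∧
      ∃ m, G.WinsIn (m + 1) c r ∧ (∀ l ≤ m, ¬ G.WinsIn l c r) ∧
        ((∃ i, c' i = r) ∨ ∀ r', G.IsGameMove r r' → G.WinsIn m c' r')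
  then h.choose else c

theorem isGameMove_bestMove {n : ℕ} (c : Fin n → V) (r : V) (i : Fin n) :
    G.IsGameMove (c i) (G.bestMove c r i) := by
  unfold bestMove
  split_ifs with h
  · exact h.choose_spec.1 i
  · exact Or.inl rfl

/-- `bestMove` answers to the least bound for the position, so the bound strictly drops although the
move does not depend on `m`. -/
theorem WinsIn.bestMove {n m : ℕ} {c : Fin n → V} {r : V} (h : G.WinsIn m c r) :
    (∃ i, G.bestMove c r i = r) ∨
      ∃ l < m, ∀ r', G.IsGameMove r r' → G.WinsIn l (G.bestMove c r) r' := by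
  classical
  have hex : ∃ m, G.WinsIn m c r := ⟨m, h⟩
  have hex' : ∃ c' : Fin n → V, (∀ i, G.IsGameMove (c i) (c' i)) ∧
      ∃ m, G.WinsIn (m + 1) c r ∧ (∀ l ≤ m, ¬ G.WinsIn l c r) ∧
        ((∃ i, c' i = r) ∨ ∀ r', G.IsGameMove r r' → G.WinsIn m c' r') := by
    obtain ⟨l, hl⟩ : ∃ l, Nat.find hex = l + 1 := by
      refine Nat.exists_eq_succ_of_ne_zero fun h0 => ?_
      have := Nat.find_spec hex
      rw [h0] at this
      exact this
    have hs := Nat.find_spec hex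
    rw [hl] at hs
    obtain ⟨c', hc', hw⟩ := hs
    exact ⟨c', hc', l, ⟨c', hc', hw⟩, fun a ha => Nat.find_min hex (by omega), hw⟩
  obtain ⟨-, l, -, hmin, hw⟩ := hex'.choose_spec
  have hb : G.bestMove c r = hex'.choose := dif_pos hex'
  rw [hb]
  refine hw.imp_right fun hw => ⟨l, ?_, hw⟩
  by_contra hlm
  exact hmin m (by omega) h

theorem CopsWin.of_winsIn {n : ℕ} (c : Fin n → V) (h : ∀ r, ∃ m, G.WinsIn m c r) :
    G.CopsWin n := by
  let σ : List V → Fin n → V := fun h => h.rec c fun v _ c' => G.bestMove c' v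
  refine ⟨σ, fun h v j => isGameMove_bestMove _ _ _, fun r hr => ?_⟩
  have key : ∀ m i, G.WinsIn m (σ (robberHistory r i)) (r i) →
      ∃ i j, σ (robberHistory r (i + 1)) j = r i := by
    intro m
    induction m using Nat.strong_induction_on with
    | _ m ih =>
      intro i hi
      obtain ⟨j, hj⟩ | ⟨l, hl, hw⟩ := hi.bestMove
      · exact ⟨i, j, hj⟩
      · exact ih l hl (i + 1) (hw _ (hr i))
  obtain ⟨m, hm⟩ := h (r 0)
  exact key m 0 hm

/-! ### Induced paths. -/

/-- The vertices `v 0, …, v d` are, in this order, an induced path of `G`. -/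
def IsInducedPath (G : SimpleGraph V) (v : ℕ → V) (d : ℕ) : Prop :=
  ∀ a b, a < b → b ≤ d → v a ≠ v b ∧ (G.Adj (v a) (v b) ↔ a + 1 = b)

namespace IsInducedPath

variable {v : ℕ → V} {d : ℕ}

theorem ne (h : G.IsInducedPath v d) {a b : ℕ} (hab : a < b) (hb : b ≤ d) : v a ≠ v b :=
  (h a b hab hb).1

theorem adj (h : G.IsInducedPath v d) {a : ℕ} (ha : a + 1 ≤ d) : G.Adj (v a) (v (a + 1)) :=
  (h a (a + 1) (by omega) ha).2.2 rfl

theorem not_adj (h : G.IsInducedPath v d) {a b : ℕ} (hab : a + 1 < b) (hb : b ≤ d) :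
    ¬ G.Adj (v a) (v b) := fun hadj =>
  absurd ((h a b (by omega) hb).2.1 hadj) (by omega)

theorem lt_of_isIndFree {k : ℕ} (h : G.IsInducedPath v d)
    (hk : G.IsIndFree (pathGraph k)) : d + 1 < k := by
  by_contra hlt
  refine hk.false (fun i : Fin k => v i) (fun i j hij => ?_) (fun i j => ?_)
  · rcases lt_trichotomy i j with hl | hl | hl
    · exact absurd hij (h.ne hl (by omega))
    · exact hl
    · exact absurd hij.symm (h.ne hl (by omega))
  · rw [pathGraph_adj]
    rcases lt_trichotomy i j with hl | hl | hl
    · rw [(h i j hl (by omega)).2]; omega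
    · subst hl; simp
    · rw [G.adj_comm, (h j i hl (by omega)).2]; omega

/-- The path is cut at the first neighbour of `r`. Only `v 0` has to be excluded: if `r` were a
later vertex, its predecessor would be an earlier neighbour. -/
theorem update (h : G.IsInducedPath v d) {j : ℕ} {r : V} (hj : j ≤ d) (hadj : G.Adj (v j) r)
    (hmin : ∀ l < j, ¬ G.Adj (v l) r) (h0 : r ≠ v 0) :
    G.IsInducedPath (Function.update v (j + 1) r) (j + 1) := by
  intro a b hab hb
  have ha' : a ≠ j + 1 := by omega
  by_cases hbj : b = j + 1
  · subst hbj
    simp only [Function.update_self, Function.update_of_ne ha', add_left_inj]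
    refine ⟨?_, ?_, ?_⟩
    · rintro rfl
      rcases a with _ | a
      · exact h0 rfl
      · exact hmin a (by omega) (h.adj (by omega))
    · intro hadj'
      by_contra hne
      exact hmin a (by omega) hadj'
    · rintro rfl; exact hadj
  · simp only [Function.update_of_ne ha', Function.update_of_ne hbj]
    exact h a b hab (by omega)

theorem exists_min_adj (h : G.IsInducedPath v d) {r : V} (hr : G.IsGameMove (v d) r)
    (h0 : r ≠ v 0) : ∃ j ≤ d, G.Adj (v j) r ∧ ∀ l < j, ¬ G.Adj (v l) r := by
  classical
  have hex : ∃ j, j ≤ d ∧ G.Adj (v j) r := by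
    rcases hr with rfl | hr
    · rcases d with _ | d
      · exact absurd rfl h0
      · exact ⟨d, by omega, h.adj le_rfl⟩
    · exact ⟨d, le_rfl, hr⟩
  obtain ⟨h1, h2⟩ := Nat.find_spec hex
  exact ⟨Nat.find hex, h1, h2, fun l hl hadj => Nat.find_min hex hl ⟨by omega, hadj⟩⟩

end IsInducedPath

theorem Reachable.exists_isInducedPath {u w : V} (h : G.Reachable u w) :
    ∃ (v : ℕ → V) (d : ℕ), G.IsInducedPath v d ∧ v 0 = u ∧ v d = w := by
  rw [reachable_iff_reflTransGen] at h
  induction h with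
  | refl => exact ⟨fun _ => u, 0, fun a b hab hb => by omega, rfl, rfl⟩
  | @tail x y _ hxy ih =>
    obtain ⟨v, d, hv, h0, hd⟩ := ih
    by_cases hy : y = v 0
    · exact ⟨fun _ => u, 0, fun a b hab hb => by omega, rfl, by rw [hy, h0]⟩
    · obtain ⟨j, hj, hadj, hmin⟩ := hv.exists_min_adj (Or.inr (hd ▸ hxy)) hy
      exact ⟨_, j + 1, hv.update hj hadj hmin hy, by simpa using h0, by simp⟩

/-! ### The train of cops. -/

/-- Cops on every third vertex of the path `v`, counted back from `v t`; all the cops that have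
not yet started stand on `v 0`. -/
def train (v : ℕ → V) (n t : ℕ) : Fin n → V := fun i => v (t - 3 * i)

theorem isGameMove_train {v : ℕ → V} {d n t : ℕ} (hv : G.IsInducedPath v d) (ht : t < d)
    (i : Fin n) : G.IsGameMove (train v n t i) (train v n (t + 1) i) := by
  unfold train
  by_cases h : 3 * (i : ℕ) ≤ t
  · rw [Nat.sub_add_comm h]
    exact Or.inr (hv.adj (by omega))
  · left
    congr 1
    omega

/-- The train of cops wins, both against a robber at the end of the path and against a robber who
left the end of the path for a vertex seeing two consecutive vertices of it behind the head of the
train. -/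
theorem winsIn_train {k n : ℕ} (hkn : k ≤ 3 * n) (hpath : G.IsIndFree (pathGraph k))
    (hclaw : G.IsIndFree clawGraph) (hbutterfly : G.IsIndFree butterflyGraph) (m : ℕ) :
    ∀ (v : ℕ → V) (d t : ℕ) (r : V), k ≤ t + m → t < d → G.IsInducedPath v d →
      (r = v d ∨ ∃ (j : ℕ) (i : Fin n), j + 3 * i = t + 1 ∧ 0 < (i : ℕ) ∧
        G.Adj (v j) r ∧ G.Adj (v (j + 1)) r ∧ G.Adj (v d) r) →
      G.WinsIn m (train v n t) r := by
  induction m with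
  | zero =>
    intro v d t r hkt htd hv
    have := hv.lt_of_isIndFree hpath
    omega
  | succ m ih =>
    intro v d t r hkt htd hv hr
    have hdk := hv.lt_of_isIndFree hpath
    -- The bounds on `t` and `d` leave at least one spare move, for capturing a robber next to a
    -- cop.
    obtain ⟨m, rfl⟩ : ∃ l, m = l + 1 := ⟨m - 1, by omega⟩
    refine ⟨train v n (t + 1), isGameMove_train hv htd, ?_⟩
    have hcop : ∀ l (s : ℕ), l + 3 * s = t + 1 → ∃ i : Fin n, train v n (t + 1) i = v l :=
      fun l s hs => ⟨⟨s, by omega⟩, congrArg v (by simp only; omega)⟩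
    by_cases hcap : ∃ i, train v n (t + 1) i = r
    · exact Or.inl hcap
    refine Or.inr fun r' hr' => ?_
    by_cases hmove : ∃ i, G.IsGameMove (train v n (t + 1) i) r'
    · exact hmove.elim fun i hi => .of_isGameMove i hi
    have hguard : ∀ l (s : ℕ), l + 3 * s = t + 1 → r' ≠ v l ∧ ¬ G.Adj (v l) r' := by
      intro l s hs
      obtain ⟨i, hi⟩ := hcop l s hs
      exact ⟨fun h => hmove ⟨i, Or.inl (h.trans hi.symm)⟩,
        fun h => hmove ⟨i, Or.inr (hi.symm ▸ h)⟩⟩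
    -- Otherwise the head now stands on the path's end, and the claw centred at `r` with leaves `v
    -- j`, `v d`, `r'` leaves no escape.
    have htd' : t + 1 < d := by
      by_contra hlt
      obtain rfl : d = t + 1 := by omega
      rcases hr with rfl | ⟨j, i, hj, hi, h1, h2, h3⟩
      · exact hcap (hcop _ 0 (by omega))
      · obtain ⟨g1, g2⟩ := hguard j i hj
        obtain ⟨g3, g4⟩ := hguard (t + 1) 0 (by omega)
        rcases hr' with rfl | hr'
        · exact g2 h1
        rcases adj_of_clawFree hclaw h1.symm h3.symm hr' (hv.ne (by omega) le_rfl) g1.symm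
          g3.symm with h | h | h
        · exact hv.not_adj (by omega) le_rfl h
        · exact g2 h
        · exact g4 h
    rcases hr with rfl | ⟨j, i, hj, hi, h1, h2, h3⟩
    · have h0 : r' ≠ v 0 ∧ ¬ G.Adj (v 0) r' := by
        have hn : 0 < n := by omega
        -- The last cop has not left `v 0`, since `t + 1 ≤ d - 1 ≤ k - 3 ≤ 3 * (n - 1)`.
        have hi : train v n (t + 1) ⟨n - 1, by omega⟩ = v 0 := by
          refine congrArg v ?_
          simp only
          omega
        exact ⟨fun h => hmove ⟨_, Or.inl (h.trans hi.symm)⟩,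
          fun h => hmove ⟨_, Or.inr (hi.symm ▸ h)⟩⟩
      obtain ⟨j, hj, hadj, hmin⟩ := hv.exists_min_adj hr' h0.1
      -- The first neighbour lies ahead of the head: rerouting the path to `r'` changes no vertex
      -- under the train.
      by_cases hjt : t + 1 < j
      · have := ih (Function.update v (j + 1) r') (j + 1) (t + 1) r' (by omega) (by omega)
          (hv.update hj hadj hmin h0.1) (Or.inl (by simp))
        convert this using 1
        funext i
        simp only [train]
        rw [Function.update_of_ne (by omega)]
      have hj0 : j ≠ 0 := by
        rintro rfl
        exact h0.2 hadj
      have hjt' : j ≠ t + 1 := by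
        rintro rfl
        exact (hguard (t + 1) 0 (by omega)).2 hadj
      have hne : r' ≠ v (j + 1) := by
        intro h
        rcases eq_or_ne j t with rfl | hlt
        · exact (hguard (j + 1) 0 (by omega)).1 h
        · rcases hr' with hr' | hr'
          · exact hv.ne (by omega) le_rfl (h.symm.trans hr')
          · exact hv.not_adj (a := j + 1) (by omega) le_rfl (h ▸ hr'.symm)
      -- Claw centred at `v j`, with leaves `v (j - 1)`, `v (j + 1)`, `r'`.
      have hadj' : G.Adj (v (j + 1)) r' := by
        obtain ⟨a, rfl⟩ := Nat.exists_eq_succ_of_ne_zero hj0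
        have hne' : v a ≠ r' := by
          rintro rfl
          rcases a with _ | a
          · exact h0.1 rfl
          · exact hmin a (by omega) (hv.adj (by omega))
        rcases adj_of_clawFree hclaw (hv.adj (a := a) (by omega)).symm
          (hv.adj (a := a + 1) (by omega)) hadj (hv.ne (by omega) (by omega)) hne'
          hne.symm with h | h | h
        · exact absurd h (hv.not_adj (by omega) (by omega))
        · exact absurd h (hmin a (by omega))
        · exact h
      -- Cops guard the indices congruent to `t + 1` modulo 3. Neither `j` nor `j + 1` is one, so
      -- these two fill a gap, and the next advance puts a cop on `v j`.
      have hmod : (j + 3 * ((t + 2 - j) / 3)) = t + 2 := by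
        by_contra hmod
        rcases (by omega : (t + 1 - j) % 3 = 0 ∨ (t + 1 - (j + 1)) % 3 = 0) with h | h
        · exact (hguard j ((t + 1 - j) / 3) (by omega)).2 hadj
        · exact (hguard (j + 1) ((t + 1 - (j + 1)) / 3) (by omega)).2 hadj'
      refine ih v d (t + 1) r' (by omega) htd' hv
        (Or.inr ⟨j, ⟨(t + 2 - j) / 3, by omega⟩, hmod, by simp only; omega, hadj, hadj', ?_⟩)
      rcases hr' with rfl | hr'
      · exact absurd hadj (hv.not_adj (by omega) le_rfl)
      · exact hr'
    · obtain ⟨g1, g2⟩ := hguard j i hj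
      rcases hr' with rfl | hr'
      · exact absurd h1 g2
      by_cases hd : r' = v d
      · exact ih v d (t + 1) r' (by omega) htd' hv (Or.inl hd)
      -- Claw at `r`, then butterfly at `r`, then claw at `v (j + 1)`: the robber still sees `v d`
      -- and the gap shifted by one.
      have hdr : G.Adj (v d) r' := by
        rcases adj_of_clawFree hclaw h1.symm h3.symm hr' (hv.ne (by omega) le_rfl) g1.symm
          (Ne.symm hd) with h | h | h
        · exact absurd h (hv.not_adj (by omega) le_rfl)
        · exact absurd h g2
        · exact h
      have hne : ∀ l, l + 1 < d → v l ≠ r' := fun l hl h =>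
        hv.not_adj hl le_rfl (h ▸ hdr.symm)
      have hjr : G.Adj (v (j + 1)) r' := by
        rcases adj_of_butterflyFree hbutterfly h1.symm h2.symm h3.symm hr'
          (hv.adj (by omega)) hdr (hv.ne (by omega) le_rfl) g1.symm
          (hv.ne (by omega) le_rfl) (hne _ (by omega)) with h | h | h | h
        · exact absurd h (hv.not_adj (by omega) le_rfl)
        · exact absurd h g2
        · exact absurd h (hv.not_adj (by omega) le_rfl)
        · exact h
      have hjr' : G.Adj (v (j + 2)) r' := by
        rcases adj_of_clawFree hclaw (hv.adj (a := j) (by omega)).symm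
          (hv.adj (a := j + 1) (by omega)) hjr (hv.ne (by omega) (by omega)) g1.symm
          (hne _ (by omega)) with h | h | h
        · exact absurd h (hv.not_adj (by omega) (by omega))
        · exact absurd h g2
        · exact h
      exact ih v d (t + 1) r' (by omega) htd' hv
        (Or.inr ⟨j + 1, i, by omega, hi, hjr, hjr', hdr⟩)

end SimpleGraph

theorem theorem1 {V : Type*} (G : SimpleGraph V) (hconn : G.Connected) (k : ℕ)
    (hpath : G.IsIndFree (SimpleGraph.pathGraph k))
    (hclaw : G.IsIndFree SimpleGraph.clawGraph)
    (hbutterfly : G.IsIndFree SimpleGraph.butterflyGraph)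
    (hC4 : G.IsIndFree (SimpleGraph.cycleGraph 4))
    (hC5 : G.IsIndFree (SimpleGraph.cycleGraph 5)) :
    G.copNumber ≤ ((⌈((k : ℚ) - 1) / 3⌉₊ + 3 : ℕ) : ℕ∞) := by
  obtain ⟨u⟩ := hconn.nonempty
  set n := ⌈((k : ℚ) - 1) / 3⌉₊ + 3 with hn
  -- This is what keeps the last cop on `v 0` throughout.
  have hkn : k ≤ 3 * n := by
    have h1 := Nat.le_ceil (((k : ℚ) - 1) / 3)
    have h2 : (k : ℚ) ≤ 3 * n := by
      rw [hn]
      push_cast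
      linarith
    exact_mod_cast h2
  have hwin : G.CopsWin n := by
    refine .of_winsIn (fun _ => u) fun r => ?_
    obtain ⟨v, d, hv, h0, hd⟩ := (hconn.preconnected u r).exists_isInducedPath
    rcases Nat.eq_zero_or_pos d with rfl | hpos
    · exact ⟨1, .of_isGameMove ⟨0, by omega⟩ (Or.inl (hd.symm.trans h0))⟩
    · refine ⟨k, ?_⟩
      have := SimpleGraph.winsIn_train hkn hpath hclaw hbutterfly k v d 0 r (by omega) hpos hv
        (Or.inl hd.symm)
      convert this using 1
      funext i
      simp [SimpleGraph.train, h0]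
  exact iInf₂_le n hwin
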